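/- Let $M^n$ be a connected smooth Riemannian manifold with Levi-Civita connection $\nabla$, and let $f\colon M^n\to\mathbb{R}^m$ be a smooth isometric immersion with normal bundle $N_fM$, normal connection $\nabla^\perp$ and second fundamental form $\alpha\colon TM\times TM\to N_fM$. Let $\tilde\nabla$ be the flat connection of $\mathbb{R}^m$, let $(\cdot)_{N_fM}$ be the orthogonal projection onto the normal space, and define the shape operators by $\langle A_\eta X,Y\rangle=\langle\alpha(X,Y),\eta\rangle$. Let $\mathcal{T}\colon M^n\to\mathbb{R}^m$ be an infinitesimal bending of $f$, that is, a smooth map with $$\langle\tilde\nabla_X\mathcal{T},f_*Y\rangle+\langle f_*X,\tilde\nabla_Y\mathcal{T}\rangle=0$$ for all tangent $X,Y$. Put $LX=\tilde\nabla_X\mathcal{T}$, let $\mathcal{Y}\eta\in TM$ be given by $\langle\mathcal{Y}\eta,X\rangle+\langle\eta,LX\rangle=0$ for all tangent $X$, and set $$\beta(X,Y)=\big(\tilde\nabla_X(LY)-L\nabla_XY\big)_{N_fM},\qquad \mathcal{E}(X,\eta)=\alpha(X,\mathcal{Y}\eta)+(LA_\eta X)_{N_fM}.$$ Then $\mathcal{T}$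 is trivial, that is, there are a skew-symmetric linear endomorphism $\mathcal{D}$ of $\mathbb{R}^m$ and $v\in\mathbb{R}^m$ with $\mathcal{T}=\mathcal{D}f+v$ on $M^n$, if and only if there is a smooth skew-symmetric section $C$ of $\mathrm{End}(N_fM)$ such that $$\beta(X,Y)=C\alpha(X,Y)\quad\text{and}\quad\mathcal{E}(X,\eta)=-(\nabla^\perp_XC)\eta$$ for all tangent vectors $X,Y$ and all smooth normal sections $\eta$, where $(\nabla^\perp_XC)\eta=\nabla^\perp_X(C\eta)-C\nabla^\perp_X\eta$. -/

import Mathlib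

open Bundle ContinuousLinearMap VectorField
open scoped Manifold ContDiff InnerProductSpace Topology

set_option linter.unusedSectionVars false

noncomputable section

namespace InfBending

/-! ### Calculus of vector-valued functions on a manifold

For `g : M → F`, `mvfderiv I g x : TangentSpace I x →L[ℝ] F` is the differential `g_*` of `g` at `x`.
It is also the flat derivative `∇̃` of `g`, seen as a section of a trivial bundle with fibre `F`. -/

section Calculus

variable {E : Type*} [NormedAddCommGroup E] [NormedSpace ℝ E]
  {H : Type*} [TopologicalSpace H] {I : ModelWithCorners ℝ E H}
  {M : Type*} [TopologicalSpace M] [ChartedSpace H M]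
  {F : Type*} [NormedAddCommGroup F] [InnerProductSpace ℝ F]

theorem mvfderiv_inner {a b : M → F} {x : M} (ha : MDiffAt a x) (hb : MDiffAt b x)
    (u : TangentSpace I x) :
    mvfderiv I (fun y ↦ ⟪a y, b y⟫_ℝ) x u =
      ⟪mvfderiv I a x u, b x⟫_ℝ + ⟪a x, mvfderiv I b x u⟫_ℝ := by
  have hs : UniqueDiffWithinAt ℝ (Set.range I) (extChartAt I x x) :=
    I.uniqueDiffOn _ (Set.mem_range_self _)
  have h := (ha.hasMFDerivAt.2.inner ℝ hb.hasMFDerivAt.2).fderivWithin hs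
  have hab : MDiffAt (fun y ↦ ⟪a y, b y⟫_ℝ) x := by
    refine (mdifferentiableAt_iff _ _).2 ⟨ha.continuousAt.inner hb.continuousAt, ?_⟩
    exact (ha.hasMFDerivAt.2.inner ℝ hb.hasMFDerivAt.2).differentiableWithinAt
  rw [hab.mvfderiv]
  have h' := congr($h u)
  have h0 : ∀ c : M → F, writtenInExtChartAt I 𝓘(ℝ, F) x c (extChartAt I x x) = c x := by
    intro c; simp [writtenInExtChartAt]; rfl
  refine h'.trans ((fderivInnerCLM_apply ℝ _ _).trans ?_)
  rw [add_comm, h0, h0]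
  rfl

variable [IsManifold I ∞ M]

theorem mdiffAt_mvfderiv {g : M → F} (hg : ContMDiff I 𝓘(ℝ, F) ∞ g)
    {Y : Π x : M, TangentSpace I x} {x : M} (hY : MDiffAt (T% Y) x) :
    MDiffAt (fun y ↦ mvfderiv I g y (Y y)) x := by
  have h1 : MDifferentiableAt I.tangent 𝓘(ℝ, F).tangent
      (tangentMap I 𝓘(ℝ, F) g) (⟨x, Y x⟩ : TangentBundle I M) :=
    (hg.contMDiff_tangentMap (m := 1) (by norm_cast)).mdifferentiableAt one_ne_zero
  have h2 := MDifferentiableAt.comp (I' := I.tangent) x h1 hY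
  have h3 := (mdifferentiableAt_totalSpace _ _).1 h2
  convert! h3.2 using 1
  ext1 y
  simp [tangentMap, mvfderiv]
  rfl

/-- Symmetry of second derivatives: `X(Y g) - Y(X g) = [X, Y] g`. -/
theorem mvfderiv_mvfderiv_sub [FiniteDimensional ℝ E] [I.Boundaryless] {g : M → F}
    (hg : ContMDiff I 𝓘(ℝ, F) ∞ g) {X Y : Π x : M, TangentSpace I x} {x : M}
    (hX : MDiffAt (T% X) x) (hY : MDiffAt (T% Y) x) :
    mvfderiv I (fun y ↦ mvfderiv I g y (Y y)) x (X x) -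
      mvfderiv I (fun y ↦ mvfderiv I g y (X y)) x (Y x) = mvfderiv I g x (mlieBracket I X Y x) := by
  set φ := extChartAt I x with hφ
  set z := φ x with hz
  have hnhds : φ.target ∈ 𝓝 z := extChartAt_target_mem_nhds x
  have hr : Set.range I ∈ 𝓝 z := Filter.mem_of_superset hnhds (extChartAt_target_subset_range x)
  set G : E → F := g ∘ φ.symm with hG
  have hGs : ∀ w ∈ φ.target, ContDiffAt ℝ ∞ G w := by
    intro w hw
    have h1 : ContMDiffAt 𝓘(ℝ, E) I ∞ φ.symm w :=
      (contMDiffOn_extChartAt_symm x).contMDiffAt ((isOpen_extChartAt_target x).mem_nhds hw)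
    exact (hg.contMDiffAt.comp w h1).contDiffAt
  have hid : ∀ v : E, (ContinuousLinearMap.id ℝ E).inverse v = v := fun v ↦ by
    rw [ContinuousLinearMap.inverse_id]; rfl
  let P (Z : Π x : M, TangentSpace I x) : E → E := mpullbackWithin 𝓘(ℝ, E) I φ.symm Z (Set.range I)
  have hP : ∀ Z : Π x : M, TangentSpace I x, MDiffAt (T% Z) x → DifferentiableAt ℝ (P Z) z := by
    intro Z hZ
    have := (hZ.mdifferentiableWithinAt
      (s := Set.univ)).differentiableWithinAt_mpullbackWithin_vectorField
    refine this.differentiableAt ?_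
    rw [Set.preimage_univ, Set.univ_inter]; exact hr
  have hPz : ∀ Z : Π x : M, TangentSpace I x, P Z z = Z x := by
    intro Z
    have h0 : φ.symm z = x := extChartAt_to_inv x
    have h1 : P Z z = (mfderivWithin 𝓘(ℝ, E) I φ.symm (Set.range I) z).inverse (Z (φ.symm z)) := rfl
    rw [h1, mfderivWithin_range_extChartAt_symm]
    exact (hid _).trans (by rw [h0])
  have key : ∀ Z : Π x : M, TangentSpace I x, MDiffAt (T% Z) x → ∀ u : E,
      mvfderiv I (fun y ↦ mvfderiv I g y (Z y)) x u =
        fderiv ℝ (fderiv ℝ G) z u (P Z z) + fderiv ℝ G z (fderiv ℝ (P Z) z u) := by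
    intro Z hZ u
    rw [(mdiffAt_mvfderiv hg hZ).mvfderiv, fderivWithin_of_mem_nhds hr]
    have heq : writtenInExtChartAt I 𝓘(ℝ, F) x (fun y ↦ mvfderiv I g y (Z y)) =ᶠ[𝓝 z]
        fun w ↦ fderiv ℝ G w (P Z w) := by
      filter_upwards [hnhds] with w hw
      have hd : MDifferentiableAt I 𝓘(ℝ, F) g (φ.symm w) :=
        hg.contMDiffAt.mdifferentiableAt (by simp)
      have hs : UniqueMDiffWithinAt 𝓘(ℝ, E) (Set.range I) w :=
        I.uniqueMDiffOn w (extChartAt_target_subset_range x hw)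
      have h1 := mfderiv_comp_mfderivWithin w hd (mdifferentiableWithinAt_extChartAt_symm hw) hs
      have hrw : Set.range I ∈ 𝓝 w := by rw [I.range_eq_univ]; exact Filter.univ_mem
      have h2 : fderiv ℝ G w = mfderivWithin 𝓘(ℝ, E) 𝓘(ℝ, F) G (Set.range I) w := by
        rw [mfderivWithin_eq_fderivWithin, fderivWithin_of_mem_nhds hrw]
      have h3 := (isInvertible_mfderivWithin_extChartAt_symm hw)
      change mfderiv I 𝓘(ℝ, F) g (φ.symm w) (Z (φ.symm w)) = fderiv ℝ G w
         ((mfderivWithin 𝓘(ℝ, E) I φ.symm (Set.range I) w).inverse (Z (φ.symm w)))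
      rw [h2, h1]
      have h4 := h3.self_apply_inverse (Z (φ.symm w))
      exact congrArg (mfderiv I 𝓘(ℝ, F) g (φ.symm w)) h4.symm
    rw [heq.fderiv_eq, fderiv_clm_apply _ (hP Z hZ)]
    · rw [add_comm]; rfl
    · exact ((hGs z (mem_extChartAt_target x)).fderiv_right (m := 1) (by norm_cast)).differentiableAt
        (by simp)
  have hbr : mvfderiv I g x (mlieBracket I X Y x) =
      fderiv ℝ G z (fderiv ℝ (P Y) z (P X z) - fderiv ℝ (P X) z (P Y z)) := by
    rw [← mlieBracketWithin_univ, mlieBracketWithin_apply, mfderiv_extChartAt_self,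
      (hg.mdifferentiableAt (by simp)).mvfderiv, fderivWithin_of_mem_nhds hr]
    refine (congrArg (fderiv ℝ G z) (hid _)).trans ?_
    have hr' : (extChartAt I x).symm ⁻¹' Set.univ ∩ Set.range I ∈ 𝓝 z := by
      rw [Set.preimage_univ, Set.univ_inter]; exact hr
    have hlb : lieBracketWithin ℝ (P X) (P Y)
        ((extChartAt I x).symm ⁻¹' Set.univ ∩ Set.range I) z =
          fderiv ℝ (P Y) z (P X z) - fderiv ℝ (P X) z (P Y z) := by
      rw [lieBracketWithin, fderivWithin_of_mem_nhds hr', fderivWithin_of_mem_nhds hr']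
    exact congrArg (fderiv ℝ G z) hlb
  have hsymm : IsSymmSndFDerivAt ℝ G z :=
    (hGs z (mem_extChartAt_target x)).isSymmSndFDerivAt (by simp; norm_cast)
  have e1 := key Y hY (X x)
  have e2 := key X hX (Y x)
  rw [hbr]
  refine (congrArg₂ (· - ·) e1 e2).trans ?_
  have e3 : fderiv ℝ (fderiv ℝ G) z (X x) (P Y z) = fderiv ℝ (fderiv ℝ G) z (Y x) (P X z) := by
    rw [hPz, hPz]; exact hsymm.eq _ _
  rw [e3, map_sub, hPz X, hPz Y]
  abel

end Calculus

/-! ### Isometric immersions -/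

section Normal

variable {E : Type*} [NormedAddCommGroup E] [NormedSpace ℝ E]
  {H : Type*} [TopologicalSpace H] (I : ModelWithCorners ℝ E H)
  {M : Type*} [TopologicalSpace M] [ChartedSpace H M]
  {F : Type*} [NormedAddCommGroup F] [InnerProductSpace ℝ F] [FiniteDimensional ℝ F]

/-- A smooth map `f : M → F` whose differential preserves inner products. -/
structure IsIsometricImmersion [RiemannianBundle (fun x : M ↦ TangentSpace I x)]
    (f : M → F) : Prop where
  contMDiff : ContMDiff I 𝓘(ℝ, F) ∞ f
  inner_map : ∀ (x : M) (u v : TangentSpace I x),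
    ⟪mvfderiv I f x u, mvfderiv I f x v⟫_ℝ = ⟪u, v⟫_ℝ

/-- The normal space `N_fM(x)`, the orthogonal complement of `f_* T_xM`. -/
def normalSpace (f : M → F) (x : M) : Submodule ℝ F := (mvfderiv I f x).rangeᗮ

/-- The normal component `w ↦ (w)_{N_fM}` at `x`. -/
def normalPart (f : M → F) (x : M) : F →L[ℝ] normalSpace I f x :=
  (normalSpace I f x).orthogonalProjectionOnto

theorem normalPart_mvfderiv (f : M → F) (x : M) (u : TangentSpace I x) :
    normalPart I f x (mvfderiv I f x u) = 0 := by
  refine Submodule.orthogonalProjectionOnto_apply_of_mem_orthogonal ?_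
  exact Submodule.le_orthogonal_orthogonal _ ⟨u, rfl⟩

/-- Smooth sections of the normal bundle. -/
def IsSmoothNormalSection (f : M → F) (η : Π x : M, normalSpace I f x) : Prop :=
  ContMDiff I 𝓘(ℝ, F) ∞ (fun x ↦ (η x : F))

/-- Smooth sections of `End(N_fM)`: the extension of `C` by zero on the tangent spaces is a
smooth map into the endomorphisms of the ambient space. -/
def IsSmoothNormalEnd (f : M → F) (C : Π x : M, normalSpace I f x →L[ℝ] normalSpace I f x) :
    Prop :=
  ContMDiff I 𝓘(ℝ, F →L[ℝ] F) ∞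
    (fun x ↦ (normalSpace I f x).subtypeL ∘L C x ∘L normalPart I f x)

/-- The normal connection: `normalConnection I f η x X` is `∇^⊥_X η` at `x`. -/
def normalConnection (f : M → F) (η : Π x : M, normalSpace I f x) (x : M) :
    TangentSpace I x →L[ℝ] normalSpace I f x :=
  normalPart I f x ∘L mvfderiv I (fun y ↦ (η y : F)) x

/-- `(∇^⊥_X C) η = ∇^⊥_X (C η) - C (∇^⊥_X η)` at `x`. -/
def normalConnectionEnd (f : M → F) (C : Π x : M, normalSpace I f x →L[ℝ] normalSpace I f x)
    (x : M) (X : TangentSpace I x) (η : Π x : M, normalSpace I f x) : normalSpace I f x :=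
  normalConnection I f (fun y ↦ C y (η y)) x X - C x (normalConnection I f η x X)

/-- `𝒯` is the restriction to `f` of a Killing field of the ambient space. -/
def IsTrivialBending {M F : Type*} [NormedAddCommGroup F] [InnerProductSpace ℝ F]
    (f 𝒯 : M → F) : Prop :=
  ∃ (D : F →ₗ[ℝ] F) (v : F), (∀ a b : F, ⟪D a, b⟫_ℝ = -⟪a, D b⟫_ℝ) ∧
    ∀ x, 𝒯 x = D (f x) + v

/-- Infinitesimal bendings: `⟨∇̃_X 𝒯, f_* Y⟩ + ⟨f_* X, ∇̃_Y 𝒯⟩ = 0`. -/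
structure IsInfinitesimalBending (f 𝒯 : M → F) : Prop where
  contMDiff : ContMDiff I 𝓘(ℝ, F) ∞ 𝒯
  inner_add_inner : ∀ (x : M) (X Y : TangentSpace I x),
    ⟪mvfderiv I 𝒯 x X, mvfderiv I f x Y⟫_ℝ + ⟪mvfderiv I f x X, mvfderiv I 𝒯 x Y⟫_ℝ = 0

end Normal

section Tensors

variable {E : Type*} [NormedAddCommGroup E] [NormedSpace ℝ E] [FiniteDimensional ℝ E]
  {H : Type*} [TopologicalSpace H] {I : ModelWithCorners ℝ E H}
  {M : Type*} [TopologicalSpace M] [ChartedSpace H M] [IsManifold I ∞ M]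
  [RiemannianBundle (fun x : M ↦ TangentSpace I x)]
  {F : Type*} [NormedAddCommGroup F] [InnerProductSpace ℝ F] [FiniteDimensional ℝ F]

instance instCompleteSpaceTangentSpace (x : M) : CompleteSpace (TangentSpace I x) :=
  have : FiniteDimensional ℝ (TangentSpace I x) := inferInstanceAs (FiniteDimensional ℝ E)
  FiniteDimensional.complete ℝ _

/-- The Levi-Civita connection `∇` of `M`. It is built from the immersion, through
`⟨∇_X Y, Z⟩ = ⟨∇̃_X f_* Y, f_* Z⟩`; the theorems `leviCivita_isMetricCompatible` and
`leviCivita_torsion` below show that it is the Levi-Civita connection of the metric of `M`.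
`leviCivita hf Y x X` is `∇_X Y` at `x`. -/
def leviCivita {f : M → F} (hf : IsIsometricImmersion I f) :
    CovariantDerivative I E (fun x : M ↦ TangentSpace I x) where
  toFun Y x := adjoint (mvfderiv I f x) ∘L mvfderiv I (fun y ↦ mvfderiv I f y (Y y)) x
  isCovariantDerivativeOnUniv :=
    { add := by
        intro Y Y' x hY hY' _
        have := mvfderiv_fun_add (mdiffAt_mvfderiv hf.contMDiff hY)
          (mdiffAt_mvfderiv hf.contMDiff hY')
        simp [this, ContinuousLinearMap.comp_add]
      leibniz := by
        intro Y g x hY hg _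
        have := mvfderiv_fun_smul hg (mdiffAt_mvfderiv hf.contMDiff hY)
        simp only [Pi.smul_apply', map_smul]
        ext1 u
        refine ext_inner_right ℝ fun v ↦ ?_
        simp [this, inner_add_left, adjoint_inner_left, inner_smul_left, hf.inner_map] }

theorem inner_leviCivita {f : M → F} (hf : IsIsometricImmersion I f)
    (Y : Π x : M, TangentSpace I x) (x : M) (u v : TangentSpace I x) :
    ⟪leviCivita hf Y x u, v⟫_ℝ =
      ⟪mvfderiv I (fun y ↦ mvfderiv I f y (Y y)) x u, mvfderiv I f x v⟫_ℝ := by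
  rw [← adjoint_inner_left]; rfl

theorem leviCivita_isMetricCompatible
    [IsContMDiffRiemannianBundle I ∞ E (fun x : M ↦ TangentSpace I x)]
    {f : M → F} (hf : IsIsometricImmersion I f) :
    (leviCivita hf).IsMetricCompatible (V := fun x : M ↦ TangentSpace I x) := by
  rw [CovariantDerivative.isMetricCompatible_iff]
  intro x X σ τ hX hσ hτ
  have h1 := inner_leviCivita hf σ x (X x) (τ x)
  have h2 := inner_leviCivita hf τ x (X x) (σ x)
  have := mvfderiv_inner (mdiffAt_mvfderiv hf.contMDiff hσ) (mdiffAt_mvfderiv hf.contMDiff hτ) (X x)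
  simp only [hf.inner_map] at this
  rw [real_inner_comm] at h2
  rw [real_inner_comm (mvfderiv I (fun y ↦ mvfderiv I f y (τ y)) x (X x)), ← h1, ← h2] at this
  exact this

theorem leviCivita_torsion [I.Boundaryless] {f : M → F} (hf : IsIsometricImmersion I f) :
    (leviCivita hf).torsion = 0 := by
  rw [CovariantDerivative.torsion_eq_zero_iff]
  intro X Y x hX hY
  refine ext_inner_right ℝ fun v ↦ ?_
  rw [inner_sub_left, inner_leviCivita, inner_leviCivita, ← inner_sub_left,
    mvfderiv_mvfderiv_sub hf.contMDiff hX hY, hf.inner_map]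

theorem tensorialAt_secondFundamentalForm {f : M → F} (hf : IsIsometricImmersion I f) (x : M) :
    TensorialAt I E (fun Y : Π x : M, TangentSpace I x ↦
      normalPart I f x ∘L mvfderiv I (fun y ↦ mvfderiv I f y (Y y)) x) x where
  smul := by
    intro g Y hg hY
    have := mvfderiv_fun_smul hg (mdiffAt_mvfderiv hf.contMDiff hY)
    simp only [Pi.smul_apply', map_smul]
    ext1 u
    simp [this, normalPart_mvfderiv]
  add := by
    intro Y Y' hY hY'
    have := mvfderiv_fun_add (mdiffAt_mvfderiv hf.contMDiff hY)
      (mdiffAt_mvfderiv hf.contMDiff hY')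
    simp [this, ContinuousLinearMap.comp_add]

/-- The second fundamental form `α(X, Y) = (∇̃_X f_* Y)_{N_fM}`. -/
def secondFundamentalForm {f : M → F} (hf : IsIsometricImmersion I f) (x : M) :
    TangentSpace I x →L[ℝ] TangentSpace I x →L[ℝ] normalSpace I f x :=
  (TensorialAt.mkHom _ x (tensorialAt_secondFundamentalForm hf x)).flip

theorem secondFundamentalForm_apply {f : M → F} (hf : IsIsometricImmersion I f) {x : M}
    (X : TangentSpace I x) {Y : Π x : M, TangentSpace I x} (hY : MDiffAt (T% Y) x) :
    secondFundamentalForm hf x X (Y x) =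
      normalPart I f x (mvfderiv I (fun y ↦ mvfderiv I f y (Y y)) x X) :=
  congr($(TensorialAt.mkHom_apply (tensorialAt_secondFundamentalForm hf x) hY) X)

/-- The shape operator: `⟨A_η X, Y⟩ = ⟨α(X, Y), η⟩`. -/
def shapeOperator {f : M → F} (hf : IsIsometricImmersion I f) (x : M)
    (η : normalSpace I f x) (X : TangentSpace I x) : TangentSpace I x :=
  adjoint (secondFundamentalForm hf x X) η

theorem inner_shapeOperator {f : M → F} (hf : IsIsometricImmersion I f) (x : M)
    (η : normalSpace I f x) (X Y : TangentSpace I x) :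
    ⟪shapeOperator hf x η X, Y⟫_ℝ = ⟪secondFundamentalForm hf x X Y, η⟫_ℝ := by
  rw [shapeOperator, adjoint_inner_left, real_inner_comm]

theorem tensorialAt_bendingB {f 𝒯 : M → F} (hf : IsIsometricImmersion I f)
    (h𝒯 : IsInfinitesimalBending I f 𝒯) (x : M) :
    TensorialAt I E (fun Y : Π x : M, TangentSpace I x ↦
      mvfderiv I (fun y ↦ mvfderiv I 𝒯 y (Y y)) x - mvfderiv I 𝒯 x ∘L leviCivita hf Y x) x where
  smul := by
    intro g Y hg hY
    have := mvfderiv_fun_smul hg (mdiffAt_mvfderiv h𝒯.contMDiff hY)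
    have h2 := (leviCivita hf).isCovariantDerivativeOnUniv.leibniz hY hg
    rw [show leviCivita hf (g • Y) x = _ from h2]
    simp only [Pi.smul_apply', map_smul]
    ext1 u
    simp [this, smul_sub]
  add := by
    intro Y Y' hY hY'
    have := mvfderiv_fun_add (mdiffAt_mvfderiv h𝒯.contMDiff hY)
      (mdiffAt_mvfderiv h𝒯.contMDiff hY')
    have h2 := (leviCivita hf).isCovariantDerivativeOnUniv.add hY hY'
    rw [show leviCivita hf (Y + Y') x = _ from h2]
    simp only [Pi.add_apply, map_add, this, ContinuousLinearMap.comp_add]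
    exact add_sub_add_comm ..

/-- The tensor `B(X, Y) = ∇̃_X (L Y) - L ∇_X Y`, where `L X = ∇̃_X 𝒯`. -/
def bendingB {f 𝒯 : M → F} (hf : IsIsometricImmersion I f)
    (h𝒯 : IsInfinitesimalBending I f 𝒯) (x : M) :
    TangentSpace I x →L[ℝ] TangentSpace I x →L[ℝ] F :=
  (TensorialAt.mkHom _ x (tensorialAt_bendingB hf h𝒯 x)).flip

theorem bendingB_apply {f 𝒯 : M → F} (hf : IsIsometricImmersion I f)
    (h𝒯 : IsInfinitesimalBending I f 𝒯) {x : M}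
    (X : TangentSpace I x) {Y : Π x : M, TangentSpace I x} (hY : MDiffAt (T% Y) x) :
    bendingB hf h𝒯 x X (Y x) = mvfderiv I (fun y ↦ mvfderiv I 𝒯 y (Y y)) x X -
      mvfderiv I 𝒯 x (leviCivita hf Y x X) :=
  congr($(TensorialAt.mkHom_apply (tensorialAt_bendingB hf h𝒯 x) hY) X)

/-- The tensor `β(X, Y) = (B(X, Y))_{N_fM}`. -/
def bendingBeta {f 𝒯 : M → F} (hf : IsIsometricImmersion I f)
    (h𝒯 : IsInfinitesimalBending I f 𝒯) (x : M) (X Y : TangentSpace I x) : normalSpace I f x :=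
  normalPart I f x (bendingB hf h𝒯 x X Y)

/-- The tensor `𝒴 : N_fM → TM` with `⟨𝒴 η, X⟩ + ⟨η, L X⟩ = 0`. -/
def bendingY (f 𝒯 : M → F) (x : M) (η : normalSpace I f x) : TangentSpace I x :=
  -adjoint (mvfderiv I 𝒯 x) (η : F)

theorem inner_bendingY (f 𝒯 : M → F) (x : M) (η : normalSpace I f x) (X : TangentSpace I x) :
    ⟪bendingY f 𝒯 x η, X⟫_ℝ + ⟪(η : F), mvfderiv I 𝒯 x X⟫_ℝ = 0 := by
  rw [bendingY, inner_neg_left, adjoint_inner_left, neg_add_cancel]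

/-- The tensor `ℰ(X, η) = α(X, 𝒴 η) + (L A_η X)_{N_fM}`. -/
def bendingE {f : M → F} (hf : IsIsometricImmersion I f) (𝒯 : M → F) (x : M)
    (X : TangentSpace I x) (η : normalSpace I f x) : normalSpace I f x :=
  secondFundamentalForm hf x X (bendingY f 𝒯 x η) +
    normalPart I f x (mvfderiv I 𝒯 x (shapeOperator hf x η X))

end Tensors

end InfBending

end

/-! If 𝒯 = 𝒟f + v, then L = 𝒟f_*, and C is the compression of 𝒟 to the normal spaces. Skewness makes
𝒴η the tangential part of 𝒟η, so the two equations come out of the Gauss and Weingarten formulas.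

Conversely, C determines a candidate for 𝒟 at every point: `ambientEnd` sends f_*X to LX and η to
f_*𝒴η + Cη. It is skew (`inner_ambientEnd`), and the point is that it is parallel. On tangent
vectors, (∇̃_X 𝒟)f_*Y = B(X,Y) - 𝒟α(X,Y). The normal part vanishes by β = Cα, the tangential part
because the tangential part of B is always 𝒴α (`adjoint_bendingB`, a Koszul-type argument). On a
normal vector the tangential part of ∇̃_X 𝒟 vanishes by skewness and the tangent case, while the
normal part is ℰ(X,η) + (∇^⊥_X C)η = 0. Connectedness makes 𝒟 constant, and then 𝒯 - 𝒟f, having zero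
differential, is constant as well. -/

noncomputable section

namespace InfBending

/-! ### Calculus of vector- and operator-valued functions -/

section Calculus

variable {E : Type*} [NormedAddCommGroup E] [NormedSpace ℝ E]
  {H : Type*} [TopologicalSpace H] {I : ModelWithCorners ℝ E H}
  {M : Type*} [TopologicalSpace M] [ChartedSpace H M]
  {F : Type*} [NormedAddCommGroup F] [NormedSpace ℝ F]
  {G : Type*} [NormedAddCommGroup G] [NormedSpace ℝ G]

/-- The product rule for the evaluation of operator-valued functions. -/
theorem mvfderiv_clm_apply {D : M → F →L[ℝ] G} {w : M → F} {x : M} (hD : MDiffAt D x)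
    (hw : MDiffAt w x) (u : TangentSpace I x) :
    mvfderiv I (fun y ↦ D y (w y)) x u =
      mvfderiv I D x u (w x) + D x (mvfderiv I w x u) := by
  have hs : UniqueDiffWithinAt ℝ (Set.range I) (extChartAt I x x) :=
    I.uniqueDiffOn _ (Set.mem_range_self _)
  have hd := hD.hasMFDerivAt.2.clm_apply hw.hasMFDerivAt.2
  have hDw : MDiffAt (fun y ↦ D y (w y)) x :=
    (mdifferentiableAt_iff _ _).2
      ⟨hD.continuousAt.clm_apply hw.continuousAt, hd.differentiableWithinAt⟩
  rw [hDw.mvfderiv]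
  refine congr($(hd.fderivWithin hs) u).trans ?_
  have h0 : writtenInExtChartAt I 𝓘(ℝ, F) x w (extChartAt I x x) = w x := by
    simp [writtenInExtChartAt]; rfl
  have h1 : writtenInExtChartAt I 𝓘(ℝ, F →L[ℝ] G) x D (extChartAt I x x) = D x := by
    simp [writtenInExtChartAt]; rfl
  rw [h0, h1]
  exact add_comm _ _

theorem mvfderiv_continuousLinearMap_comp (D : F →L[ℝ] G) {w : M → F} {x : M}
    (hw : MDiffAt w x) (u : TangentSpace I x) :
    mvfderiv I (fun y ↦ D (w y)) x u = D (mvfderiv I w x u) := by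
  rw [mvfderiv_clm_apply (D := fun _ ↦ D) mdifferentiableAt_const hw, mvfderiv_const]
  simp

/-- A function with vanishing differential on a connected manifold is constant. -/
theorem eq_of_mvfderiv_eq_zero [I.Boundaryless] [IsManifold I 1 M] [PreconnectedSpace M]
    {g : M → F} (hg : MDiff g) (h : ∀ x, mvfderiv I g x = 0) (x y : M) : g x = g y := by
  refine IsLocallyConstant.apply_eq_of_preconnectedSpace ?_ x y
  rw [IsLocallyConstant.iff_eventually_eq]
  intro x
  set φ := extChartAt I x
  have hd : ∀ w ∈ φ.target, HasFDerivAt (g ∘ φ.symm) (0 : E →L[ℝ] F) w := by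
    intro w hw
    have h1 : MDifferentiableAt 𝓘(ℝ, E) I φ.symm w := by
      have := mdifferentiableWithinAt_extChartAt_symm (I := I) hw
      rwa [I.range_eq_univ, mdifferentiableWithinAt_univ] at this
    have h2 : mfderiv I 𝓘(ℝ, F) g (φ.symm w) = 0 := h (φ.symm w)
    have h3 := (hg (φ.symm w)).hasMFDerivAt.comp w h1.hasMFDerivAt
    rw [h2] at h3
    have h4 : HasMFDerivAt 𝓘(ℝ, E) 𝓘(ℝ, F) (g ∘ φ.symm) w (0 : E →L[ℝ] F) := by
      convert! h3 using 1
    exact h4.hasFDerivAt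
  -- The chart target need not be connected: zero derivative on an open set already makes level sets
  -- open there.
  have hopen := (isOpen_extChartAt_target (I := I) x).isOpen_inter_preimage_of_fderiv_eq_zero
    (𝕜 := ℝ) (fun w hw ↦ (hd w hw).differentiableAt.differentiableWithinAt)
    (fun w hw ↦ (hd w hw).fderiv) {g x}
  have hx : φ x ∈ φ.target ∩ (g ∘ φ.symm) ⁻¹' {g x} :=
    ⟨mem_extChartAt_target x, by simp [φ]⟩
  filter_upwards [(continuousAt_extChartAt (I := I) x).preimage_mem_nhds (hopen.mem_nhds hx),
    extChartAt_source_mem_nhds (I := I) x] with y hy hys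
  exact (congrArg g ((extChartAt I x).left_inv hys)).symm.trans hy.2

/-- The tangent map of g is smooth; compose it with Y and read off the fibre component. -/
theorem contMDiffAt_mvfderiv [IsManifold I ∞ M] {g : M → F} (hg : ContMDiff I 𝓘(ℝ, F) ∞ g)
    {Y : Π x : M, TangentSpace I x} {x : M} (hY : CMDiffAt ∞ (T% Y) x) :
    CMDiffAt ∞ (fun y ↦ mvfderiv I g y (Y y)) x := by
  have h1 : ContMDiffAt I.tangent 𝓘(ℝ, F).tangent ∞
      (tangentMap I 𝓘(ℝ, F) g) (⟨x, Y x⟩ : TangentBundle I M) :=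
    (hg.contMDiff_tangentMap (m := ∞) (by norm_cast)).contMDiffAt
  have h2 := ContMDiffAt.comp (I' := I.tangent) x h1 hY
  have h3 := (contMDiffAt_totalSpace).1 h2
  convert! h3.2 using 1
  ext1 y
  simp [tangentMap, mvfderiv]
  rfl

/-- An operator-valued function on a finite-dimensional space is smooth if it is so pointwise. -/
theorem contMDiffAt_clm_of_apply [FiniteDimensional ℝ F] {D : M → F →L[ℝ] G} {x : M}
    (h : ∀ w, CMDiffAt ∞ (fun y ↦ D y w) x) : CMDiffAt ∞ D x := by
  let b := Module.finBasis ℝ F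
  -- In a basis b with coordinate functionals b_i^*, the operator is the sum of the rank-one maps
  -- b_i^* ⊗ D(b_i).
  have hD : D = fun y ↦ ∑ i,
      smulRightL ℝ F G (LinearMap.toContinuousLinearMap (b.coord i)) (D y (b i)) := by
    ext y w
    conv_lhs => rw [← b.sum_repr w, map_sum]
    simp
  rw [hD]
  exact contMDiffAt_finsetSum fun i _ ↦
    (ContinuousLinearMap.contMDiffAt _).comp x (h (b i))

end Calculus

/-! ### Smoothness of adjoints of differentials -/

section Adjoint

variable {E : Type*} [NormedAddCommGroup E] [InnerProductSpace ℝ E] [FiniteDimensional ℝ E]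
  {H : Type*} [TopologicalSpace H] {I : ModelWithCorners ℝ E H}
  {M : Type*} [TopologicalSpace M] [ChartedSpace H M] [IsManifold I ∞ M]
  [RiemannianBundle (fun x : M ↦ TangentSpace I x)]
  {F : Type*} [NormedAddCommGroup F] [InnerProductSpace ℝ F] [FiniteDimensional ℝ F]

theorem contMDiffAt_adjoint {A : M → E →L[ℝ] F} {x : M} (hA : CMDiffAt ∞ A x) :
    CMDiffAt ∞ (fun y ↦ adjoint (A y)) x := by
  let J : (E →L[ℝ] F) →L[ℝ] (F →L[ℝ] E) := LinearMap.toContinuousLinearMap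
    { toFun := fun B ↦ adjoint B
      map_add' := fun B B' ↦ map_add _ B B'
      map_smul' := fun c B ↦ by simp }
  exact (J.contMDiffAt (n := ∞)).comp x hA

/-- The adjoint of the differential of a smooth map sends smooth functions to smooth vector fields.
The metric enters through an isometric immersion. -/
theorem contMDiffAt_adjoint_mvfderiv {f g : M → F} (hf : IsIsometricImmersion I f)
    (hg : ContMDiff I 𝓘(ℝ, F) ∞ g) {w : M → F} {x : M} (hw : CMDiffAt ∞ w x) :
    CMDiffAt ∞ (T% (fun y ↦ adjoint (mvfderiv I g y) (w y))) x := by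
  set e := trivializationAt E (TangentSpace I : M → Type _) x with he
  have hb : ∀ᶠ y in 𝓝 x, y ∈ e.baseSet :=
    e.open_baseSet.mem_nhds (FiberBundle.mem_baseSet_trivializationAt' x)
  let τ (y : M) : E →L[ℝ] TangentSpace I y := e.symmL ℝ y
  have hτ : ∀ y ∈ e.baseSet, ∀ u : TangentSpace I y, τ y (e ⟨y, u⟩).2 = u := by
    intro y hy u
    have := e.symmL_continuousLinearMapAt (R := ℝ) hy u
    rwa [Trivialization.continuousLinearMapAt_apply, e.linearMapAt_def_of_mem hy] at this
  have hτ' : ∀ y ∈ e.baseSet, ∀ v : E, (e ⟨y, τ y v⟩).2 = v := by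
    intro y hy v
    have := e.continuousLinearMapAt_symmL (R := ℝ) hy v
    rwa [Trivialization.continuousLinearMapAt_apply, e.linearMapAt_def_of_mem hy] at this
  have hA : ∀ k : M → F, ContMDiff I 𝓘(ℝ, F) ∞ k →
      CMDiffAt ∞ (fun y ↦ (mvfderiv I k y ∘L τ y : E →L[ℝ] F)) x := by
    intro k hk
    refine contMDiffAt_clm_of_apply fun v ↦ contMDiffAt_mvfderiv hk ?_
    rw [contMDiffAt_section]
    refine (contMDiffAt_const (c := v)).congr_of_eventuallyEq ?_
    filter_upwards [hb] with y hy using hτ' y hy v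
  -- `A k y` is the differential of k in a local frame, and its adjoint uses the fixed inner product
  -- of E, not the metric of M. The metric is recovered as the Gram operator (A f)^*(A f),
  -- invertible since f_* is isometric. The coordinates c of the vector field then solve the normal
  -- equation (A f)^*(A f) c = (A g)^* w, and inversion of operators is smooth.
  let A (k : M → F) (y : M) : E →L[ℝ] F := mvfderiv I k y ∘L τ y
  have hGs : CMDiffAt ∞ (fun y ↦ adjoint (A f y) ∘L A f y) x :=
    (contMDiffAt_adjoint (hA f hf.contMDiff)).clm_comp (hA f hf.contMDiff)
  have hunit : ∀ y ∈ e.baseSet, IsUnit (adjoint (A f y) ∘L A f y) := by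
    intro y hy
    rw [ContinuousLinearMap.isUnit_iff_bijective]
    have hinj : Function.Injective (adjoint (A f y) ∘L A f y) := by
      refine (injective_iff_map_eq_zero _).2 fun v hv ↦ ?_
      have h1 : ⟪A f y v, A f y v⟫_ℝ = 0 := by
        rw [← adjoint_inner_left]
        exact (congrArg (fun z ↦ ⟪z, v⟫_ℝ) hv).trans (inner_zero_left _)
      have h2 : ⟪τ y v, τ y v⟫_ℝ = 0 := by rw [← hf.inner_map]; exact h1
      have h3 := hτ' y hy v
      rw [inner_self_eq_zero.1 h2, ← hτ' y hy 0, map_zero] at *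
      exact h3.symm
    exact ⟨hinj, LinearMap.injective_iff_surjective
      (f := (adjoint (A f y) ∘L A f y : E →L[ℝ] E).toLinearMap).1 hinj⟩
  rw [contMDiffAt_section]
  obtain ⟨U, hU⟩ := hunit x hb.self_of_nhds
  have hinv : CMDiffAt ∞ (fun y ↦ Ring.inverse (adjoint (A f y) ∘L A f y)) x := by
    have := contDiffAt_ringInverse (n := ∞) ℝ U
    rw [hU] at this
    exact ContDiffAt.comp_contMDiffAt (f := fun y ↦ adjoint (A f y) ∘L A f y) this hGs
  refine (hinv.clm_apply ((contMDiffAt_adjoint (hA g hg)).clm_apply hw)).congr_of_eventuallyEq ?_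
  filter_upwards [hb] with y hy
  set u := adjoint (mvfderiv I g y) (w y) with hu
  have hGc : (adjoint (A f y) ∘L A f y) (e ⟨y, u⟩).2 = adjoint (A g y) (w y) := by
    refine ext_inner_right ℝ fun v ↦ ?_
    have h1 : A f y (e ⟨y, u⟩).2 = mvfderiv I f y u := congrArg _ (hτ y hy u)
    rw [ContinuousLinearMap.comp_apply, adjoint_inner_left, adjoint_inner_left, h1]
    change ⟪mvfderiv I f y u, mvfderiv I f y (τ y v)⟫_ℝ = ⟪w y, mvfderiv I g y (τ y v)⟫_ℝ
    rw [hf.inner_map, hu, adjoint_inner_left]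
  change (e ⟨y, u⟩).2 = Ring.inverse (adjoint (A f y) ∘L A f y) (adjoint (A g y) (w y))
  rw [← hGc]
  exact congr($(Ring.inverse_mul_cancel _ (hunit y hy)) (e ⟨y, u⟩).2).symm

end Adjoint

/-! ### Tangential and normal components, Gauss and Weingarten formulas -/

section Submanifold

variable {E : Type*} [NormedAddCommGroup E] [InnerProductSpace ℝ E] [FiniteDimensional ℝ E]
  {H : Type*} [TopologicalSpace H] {I : ModelWithCorners ℝ E H}
  {M : Type*} [TopologicalSpace M] [ChartedSpace H M] [IsManifold I ∞ M]
  [RiemannianBundle (fun x : M ↦ TangentSpace I x)]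
  {F : Type*} [NormedAddCommGroup F] [InnerProductSpace ℝ F] [FiniteDimensional ℝ F]
  {f 𝒯 : M → F}

theorem adjoint_mvfderiv_mvfderiv (hf : IsIsometricImmersion I f) (x : M)
    (u : TangentSpace I x) : adjoint (mvfderiv I f x) (mvfderiv I f x u) = u := by
  refine ext_inner_right ℝ fun v ↦ ?_
  rw [adjoint_inner_left, hf.inner_map]

theorem inner_mvfderiv_normal (x : M) (u : TangentSpace I x) (η : normalSpace I f x) :
    ⟪mvfderiv I f x u, (η : F)⟫_ℝ = 0 :=
  (Submodule.mem_orthogonal _ _).1 η.2 _ ⟨u, rfl⟩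

theorem adjoint_mvfderiv_normal (x : M) (η : normalSpace I f x) :
    adjoint (mvfderiv I f x) (η : F) = 0 := by
  refine ext_inner_right ℝ fun v ↦ ?_
  rw [adjoint_inner_left, real_inner_comm, inner_mvfderiv_normal, inner_zero_left]

theorem normalPart_normal (x : M) (η : normalSpace I f x) : normalPart I f x (η : F) = η :=
  Submodule.orthogonalProjectionOnto_mem_subspace_eq_self η

/-- For an isometric f_*, the operator f_* f_*^* is the orthogonal projection onto the tangent
space. This formula reduces smoothness of the normal projection to that of adjoints. -/
theorem coe_normalPart (hf : IsIsometricImmersion I f) (x : M) (w : F) :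
    (normalPart I f x w : F) = w - mvfderiv I f x (adjoint (mvfderiv I f x) w) := by
  have hmem : w - mvfderiv I f x (adjoint (mvfderiv I f x) w) ∈ normalSpace I f x := by
    refine (Submodule.mem_orthogonal _ _).2 ?_
    rintro _ ⟨u, rfl⟩
    change ⟪mvfderiv I f x u, _⟫_ℝ = 0
    rw [inner_sub_right, hf.inner_map, adjoint_inner_right, sub_self]
  have h := normalPart_normal x ⟨_, hmem⟩
  rw [map_sub, normalPart_mvfderiv, sub_zero] at h
  exact congrArg Subtype.val h

theorem mvfderiv_adjoint_add_normalPart (hf : IsIsometricImmersion I f) (x : M) (w : F) :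
    mvfderiv I f x (adjoint (mvfderiv I f x) w) + (normalPart I f x w : F) = w := by
  rw [coe_normalPart hf, add_sub_cancel]

theorem inner_normalPart_left (x : M) (w : F) (η : normalSpace I f x) :
    ⟪normalPart I f x w, η⟫_ℝ = ⟪w, (η : F)⟫_ℝ :=
  Submodule.inner_orthogonalProjectionOnto_eq_of_mem_right η w

/-- With constant w, this extends any normal vector to a global smooth normal section. -/
theorem contMDiff_normalPart (hf : IsIsometricImmersion I f) {w : M → F}
    (hw : ContMDiff I 𝓘(ℝ, F) ∞ w) :
    ContMDiff I 𝓘(ℝ, F) ∞ (fun y ↦ (normalPart I f y (w y) : F)) := by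
  simp only [coe_normalPart hf]
  exact hw.sub fun y ↦ contMDiffAt_mvfderiv hf.contMDiff
    (contMDiffAt_adjoint_mvfderiv hf hf.contMDiff (hw y))

/-- A smooth vector field extending the tangent vector `u` at `x`. -/
def tangentExtension (f : M → F) {x : M} (u : TangentSpace I x) (y : M) : TangentSpace I y :=
  adjoint (mvfderiv I f y) (mvfderiv I f x u)

theorem tangentExtension_self (hf : IsIsometricImmersion I f) {x : M} (u : TangentSpace I x) :
    tangentExtension f u x = u :=
  adjoint_mvfderiv_mvfderiv hf x u

theorem mdiffAt_tangentExtension (hf : IsIsometricImmersion I f) {x : M} (u : TangentSpace I x)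
    (y : M) : MDiffAt (T% (tangentExtension f u)) y :=
  (contMDiffAt_adjoint_mvfderiv hf hf.contMDiff contMDiffAt_const).mdifferentiableAt (by simp)

/-- The Gauss formula. -/
theorem gauss_formula (hf : IsIsometricImmersion I f) {x : M} (X : TangentSpace I x)
    {Y : Π x : M, TangentSpace I x} (hY : MDiffAt (T% Y) x) :
    mvfderiv I (fun y ↦ mvfderiv I f y (Y y)) x X =
      mvfderiv I f x (leviCivita hf Y x X) + (secondFundamentalForm hf x X (Y x) : F) := by
  rw [secondFundamentalForm_apply hf X hY]
  exact (mvfderiv_adjoint_add_normalPart hf x _).symm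

/-- The Weingarten formula. -/
theorem weingarten_formula (hf : IsIsometricImmersion I f) {x : M} (X : TangentSpace I x)
    {η : Π x : M, normalSpace I f x} (hη : MDiffAt (fun y ↦ (η y : F)) x) :
    mvfderiv I (fun y ↦ (η y : F)) x X =
      -mvfderiv I f x (shapeOperator hf x (η x) X) + (normalConnection I f η x X : F) := by
  have h : adjoint (mvfderiv I f x) (mvfderiv I (fun y ↦ (η y : F)) x X) =
      -shapeOperator hf x (η x) X := by
    refine ext_inner_right ℝ fun Z ↦ ?_
    have hZ := mdiffAt_tangentExtension hf Z x
    have h0 := mvfderiv_inner hη (mdiffAt_mvfderiv hf.contMDiff hZ) X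
    -- The tangential component comes from differentiating ⟨η, f_*Z⟩ = 0.
    have h1 : (fun y ↦ ⟪(η y : F), mvfderiv I f y (tangentExtension f Z y)⟫_ℝ) = fun _ ↦ 0 := by
      funext y
      rw [real_inner_comm, inner_mvfderiv_normal]
    rw [h1, mvfderiv_const, gauss_formula hf X hZ, tangentExtension_self hf, inner_add_right,
      real_inner_comm _ (η x : F), inner_mvfderiv_normal] at h0
    rw [adjoint_inner_left, inner_neg_left, inner_shapeOperator, Submodule.coe_inner,
      real_inner_comm (η x : F)]
    simp only [zero_apply] at h0
    linarith
  rw [← map_neg, ← h]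
  exact (mvfderiv_adjoint_add_normalPart hf x _).symm

/-! ### The symmetries of α and B, and the tangential part of B -/

section Symmetry

variable [I.Boundaryless]

theorem secondFundamentalForm_symm (hf : IsIsometricImmersion I f) (x : M)
    (X Y : TangentSpace I x) :
    secondFundamentalForm hf x X Y = secondFundamentalForm hf x Y X := by
  have hX := mdiffAt_tangentExtension hf X x
  have hY := mdiffAt_tangentExtension hf Y x
  have h1 := secondFundamentalForm_apply hf X hY
  have h2 := secondFundamentalForm_apply hf Y hX
  have h := mvfderiv_mvfderiv_sub hf.contMDiff hX hY
  rw [tangentExtension_self hf] at h1 h2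
  rw [tangentExtension_self hf, tangentExtension_self hf] at h
  rw [h1, h2, ← sub_eq_zero, ← map_sub, h, normalPart_mvfderiv]

/-- The second derivatives of 𝒯 differ by L[X,Y], which cancels against L(∇_X Y - ∇_Y X) because ∇
is torsion-free. -/
theorem bendingB_symm (hf : IsIsometricImmersion I f) (h𝒯 : IsInfinitesimalBending I f 𝒯) (x : M)
    (X Y : TangentSpace I x) : bendingB hf h𝒯 x X Y = bendingB hf h𝒯 x Y X := by
  have hX := mdiffAt_tangentExtension hf X x
  have hY := mdiffAt_tangentExtension hf Y x
  have h1 := bendingB_apply hf h𝒯 X hY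
  have h2 := bendingB_apply hf h𝒯 Y hX
  have h := mvfderiv_mvfderiv_sub h𝒯.contMDiff hX hY
  have ht := (CovariantDerivative.torsion_eq_zero_iff _).1 (leviCivita_torsion hf) hX hY
  rw [tangentExtension_self hf] at h1 h2
  rw [tangentExtension_self hf, tangentExtension_self hf] at h ht
  rw [h1, h2, ← sub_eq_zero, sub_sub_sub_comm, h, ← map_sub, ht, sub_self]

/-- This is the bending equation for (Y,Z) differentiated along X. The terms with ∇_X Y and ∇_X Z
drop out by the bending equation itself. Hence ⟨B(X,Y), f_*Z⟩ + ⟨α(X,Y), LZ⟩ is skew in Y, Z. -/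
theorem inner_bendingB_add (hf : IsIsometricImmersion I f) (h𝒯 : IsInfinitesimalBending I f 𝒯)
    (x : M) (X Y Z : TangentSpace I x) :
    (⟪bendingB hf h𝒯 x X Y, mvfderiv I f x Z⟫_ℝ +
        ⟪(secondFundamentalForm hf x X Y : F), mvfderiv I 𝒯 x Z⟫_ℝ) +
      (⟪bendingB hf h𝒯 x X Z, mvfderiv I f x Y⟫_ℝ +
        ⟪(secondFundamentalForm hf x X Z : F), mvfderiv I 𝒯 x Y⟫_ℝ) = 0 := by
  have hY := mdiffAt_tangentExtension hf Y x
  have hZ := mdiffAt_tangentExtension hf Z x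
  have hmY := mdiffAt_mvfderiv hf.contMDiff hY
  have hmZ := mdiffAt_mvfderiv hf.contMDiff hZ
  have htY := mdiffAt_mvfderiv h𝒯.contMDiff hY
  have htZ := mdiffAt_mvfderiv h𝒯.contMDiff hZ
  have h1 := mvfderiv_inner htY hmZ X
  have h2 := mvfderiv_inner htZ hmY X
  -- The sign is written as the linear map -id so that the chain rule for linear maps applies.
  have hneg : (fun y ↦ ⟪mvfderiv I 𝒯 y (tangentExtension f Z y),
      mvfderiv I f y (tangentExtension f Y y)⟫_ℝ) =
      fun y ↦ (-ContinuousLinearMap.id ℝ ℝ) ⟪mvfderiv I 𝒯 y (tangentExtension f Y y),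
        mvfderiv I f y (tangentExtension f Z y)⟫_ℝ := by
    funext y
    have := h𝒯.inner_add_inner y (tangentExtension f Y y) (tangentExtension f Z y)
    rw [real_inner_comm (mvfderiv I 𝒯 y (tangentExtension f Z y))] at this
    simp only [neg_apply, ContinuousLinearMap.id_apply]
    linarith
  have hd : MDiffAt (fun y ↦ ⟪mvfderiv I 𝒯 y (tangentExtension f Y y),
      mvfderiv I f y (tangentExtension f Z y)⟫_ℝ) x :=
    (mdifferentiableAt_iff _ _).2 ⟨htY.continuousAt.inner hmZ.continuousAt,
      (htY.hasMFDerivAt.2.inner ℝ hmZ.hasMFDerivAt.2).differentiableWithinAt⟩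
  rw [hneg, mvfderiv_continuousLinearMap_comp _ hd, h1] at h2
  have bY := bendingB_apply hf h𝒯 X hY
  have bZ := bendingB_apply hf h𝒯 X hZ
  rw [eq_sub_iff_add_eq] at bY bZ
  rw [← bY, ← bZ, gauss_formula hf X hY, gauss_formula hf X hZ] at h2
  simp only [tangentExtension_self hf] at h2
  simp only [inner_add_left, inner_add_right, neg_apply, ContinuousLinearMap.id_apply] at h2
  have e1 := h𝒯.inner_add_inner x (leviCivita hf (tangentExtension f Y) x X) Z
  have e2 := h𝒯.inner_add_inner x Y (leviCivita hf (tangentExtension f Z) x X)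
  rw [real_inner_comm _ (mvfderiv I f x _)] at e1 e2
  rw [real_inner_comm (mvfderiv I 𝒯 x Y) (secondFundamentalForm hf x X Z : F),
    real_inner_comm (mvfderiv I 𝒯 x Z) (secondFundamentalForm hf x X Y : F)]
  linarith

/-- The tangential component of `B(X, Y)` is `𝒴 α(X, Y)`. -/
theorem adjoint_bendingB (hf : IsIsometricImmersion I f) (h𝒯 : IsInfinitesimalBending I f 𝒯)
    (x : M) (X Y : TangentSpace I x) :
    adjoint (mvfderiv I f x) (bendingB hf h𝒯 x X Y) =
      bendingY f 𝒯 x (secondFundamentalForm hf x X Y) := by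
  refine ext_inner_right ℝ fun Z ↦ ?_
  -- A trilinear form symmetric in its first two arguments and skew in its last two is zero: adding
  -- the first two cyclic instances and subtracting the third leaves twice the form.
  have h1 := inner_bendingB_add hf h𝒯 x X Y Z
  have h2 := inner_bendingB_add hf h𝒯 x Y Z X
  have h3 := inner_bendingB_add hf h𝒯 x Z X Y
  rw [bendingB_symm hf h𝒯 x Z X, bendingB_symm hf h𝒯 x Z Y, secondFundamentalForm_symm hf x Z X,
    secondFundamentalForm_symm hf x Z Y] at h3
  rw [bendingB_symm hf h𝒯 x Y X, secondFundamentalForm_symm hf x Y X] at h2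
  rw [adjoint_inner_left]
  have h4 := inner_bendingY f 𝒯 x (secondFundamentalForm hf x X Y) Z
  linarith

end Symmetry

end Submanifold

/-! ### Trivial bendings satisfy the two equations -/

section TrivialBending

variable {E : Type*} [NormedAddCommGroup E] [InnerProductSpace ℝ E] [FiniteDimensional ℝ E]
  {H : Type*} [TopologicalSpace H] {I : ModelWithCorners ℝ E H}
  {M : Type*} [TopologicalSpace M] [ChartedSpace H M] [IsManifold I ∞ M]
  [RiemannianBundle (fun x : M ↦ TangentSpace I x)]
  {F : Type*} [NormedAddCommGroup F] [InnerProductSpace ℝ F] [FiniteDimensional ℝ F]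
  {f 𝒯 : M → F}

/-- The compression of an ambient endomorphism to the normal spaces. -/
def normalCompression (I : ModelWithCorners ℝ E H) (f : M → F) (D : F →L[ℝ] F) (x : M) :
    normalSpace I f x →L[ℝ] normalSpace I f x :=
  normalPart I f x ∘L D ∘L (normalSpace I f x).subtypeL

theorem normalCompression_apply (D : F →L[ℝ] F) (x : M) (η : normalSpace I f x) :
    normalCompression I f D x η = normalPart I f x (D η) := rfl

theorem isSmoothNormalEnd_normalCompression (hf : IsIsometricImmersion I f) (D : F →L[ℝ] F) :
    IsSmoothNormalEnd I f (normalCompression I f D) := by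
  intro x
  refine contMDiffAt_clm_of_apply fun w ↦ ?_
  exact contMDiff_normalPart hf
    ((D.contMDiff (n := ∞)).comp (contMDiff_normalPart hf contMDiff_const)) x

theorem inner_normalCompression {D : F →L[ℝ] F} (hD : ∀ a b : F, ⟪D a, b⟫_ℝ = -⟪a, D b⟫_ℝ) (x : M)
    (η ξ : normalSpace I f x) :
    ⟪normalCompression I f D x η, ξ⟫_ℝ = -⟪η, normalCompression I f D x ξ⟫_ℝ := by
  rw [real_inner_comm _ η, normalCompression_apply, normalCompression_apply,
    inner_normalPart_left, inner_normalPart_left, hD, real_inner_comm]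

theorem mvfderiv_of_eq_add_const (hf : IsIsometricImmersion I f) {D : F →L[ℝ] F} {v : F}
    (h : ∀ x, 𝒯 x = D (f x) + v) (x : M) (u : TangentSpace I x) :
    mvfderiv I 𝒯 x u = D (mvfderiv I f x u) := by
  have hfd : MDiffAt f x := hf.contMDiff.mdifferentiableAt (by simp)
  have hDf : MDiffAt (fun y ↦ D (f y)) x :=
    ((D.contMDiff (n := ∞)).comp hf.contMDiff).mdifferentiableAt (by simp)
  rw [show 𝒯 = fun y ↦ D (f y) + v from funext h, mvfderiv_fun_add hDf mdifferentiableAt_const,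
    mvfderiv_const, add_zero, mvfderiv_continuousLinearMap_comp D hfd]

/-- Since L = 𝒟f_*, the Gauss formula gives B = 𝒟α even before projecting. -/
theorem bendingBeta_of_eq_add_const (hf : IsIsometricImmersion I f)
    (h𝒯 : IsInfinitesimalBending I f 𝒯) {D : F →L[ℝ] F} {v : F}
    (h : ∀ x, 𝒯 x = D (f x) + v) (x : M) (X Y : TangentSpace I x) :
    bendingBeta hf h𝒯 x X Y =
      normalCompression I f D x (secondFundamentalForm hf x X Y) := by
  have hY := mdiffAt_tangentExtension hf Y x
  have hB := bendingB_apply hf h𝒯 X hY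
  simp only [mvfderiv_of_eq_add_const hf h] at hB
  rw [mvfderiv_continuousLinearMap_comp D (mdiffAt_mvfderiv hf.contMDiff hY),
    gauss_formula hf X hY, map_add, add_sub_cancel_left, tangentExtension_self hf] at hB
  rw [bendingBeta, hB, normalCompression_apply]

theorem bendingY_of_eq_add_const (hf : IsIsometricImmersion I f) {D : F →L[ℝ] F} {v : F}
    (hD : ∀ a b : F, ⟪D a, b⟫_ℝ = -⟪a, D b⟫_ℝ) (h : ∀ x, 𝒯 x = D (f x) + v) (x : M)
    (η : normalSpace I f x) : bendingY f 𝒯 x η = adjoint (mvfderiv I f x) (D η) := by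
  refine ext_inner_right ℝ fun u ↦ ?_
  have := inner_bendingY f 𝒯 x η u
  rw [mvfderiv_of_eq_add_const hf h] at this
  rw [adjoint_inner_left, hD]
  linarith

theorem contMDiffAt_bendingY (hf : IsIsometricImmersion I f)
    (h𝒯 : IsInfinitesimalBending I f 𝒯) {η : Π x : M, normalSpace I f x}
    (hη : IsSmoothNormalSection I f η) (x : M) :
    CMDiffAt ∞ (T% (fun y ↦ bendingY f 𝒯 y (η y))) x := by
  have h := contMDiffAt_adjoint_mvfderiv hf h𝒯.contMDiff (w := fun y ↦ -(η y : F)) (hη.neg x)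
  simp only [map_neg] at h
  exact h

/-- Write Cη = 𝒟η - f_*𝒴η and take the normal part of its derivative: the Weingarten formula turns
𝒟∇̃_X η into -LA_η X + 𝒟∇^⊥_X η, and the Gauss formula gives α(X, 𝒴η). -/
theorem bendingE_of_eq_add_const (hf : IsIsometricImmersion I f)
    (h𝒯 : IsInfinitesimalBending I f 𝒯) {D : F →L[ℝ] F} {v : F}
    (hD : ∀ a b : F, ⟪D a, b⟫_ℝ = -⟪a, D b⟫_ℝ) (h : ∀ x, 𝒯 x = D (f x) + v) (x : M)
    (X : TangentSpace I x) {η : Π x : M, normalSpace I f x} (hη : IsSmoothNormalSection I f η) :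
    bendingE hf 𝒯 x X (η x) = -normalConnectionEnd I f (normalCompression I f D) x X η := by
  have hηd : MDiffAt (fun y ↦ (η y : F)) x := hη.mdifferentiableAt (by simp)
  have hDη : MDiffAt (fun y ↦ D (η y : F)) x :=
    ((D.contMDiff (n := ∞)).comp hη).mdifferentiableAt (by simp)
  have hYd := (contMDiffAt_bendingY hf h𝒯 hη x).mdifferentiableAt (by simp)
  have hC : (fun y ↦ (normalCompression I f D y (η y) : F)) =
      fun y ↦ D (η y : F) - mvfderiv I f y (bendingY f 𝒯 y (η y)) := by
    funext y
    rw [normalCompression_apply, coe_normalPart hf, bendingY_of_eq_add_const hf hD h]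
  rw [normalConnectionEnd, normalConnection, ContinuousLinearMap.comp_apply, hC,
    mvfderiv_fun_sub hDη (mdiffAt_mvfderiv hf.contMDiff hYd), sub_apply, map_sub,
    ← secondFundamentalForm_apply hf X hYd, mvfderiv_continuousLinearMap_comp D hηd,
    weingarten_formula hf X hηd, map_add, map_neg, map_add, map_neg,
    ← mvfderiv_of_eq_add_const hf h, normalCompression_apply, bendingE]
  abel

/-! ### Reconstruction of the Killing field from C -/

/-- The endomorphism of the ambient space at `x` that sends `f_* X` to `∇̃_X 𝒯` and the normal
vector `η` to `f_* 𝒴 η + C η`. -/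
def ambientEnd (f 𝒯 : M → F) (C : Π x : M, normalSpace I f x →L[ℝ] normalSpace I f x) (x : M) :
    F →L[ℝ] F :=
  mvfderiv I 𝒯 x ∘L adjoint (mvfderiv I f x) +
    (((normalSpace I f x).subtypeL ∘L C x ∘L normalPart I f x) -
      mvfderiv I f x ∘L adjoint (mvfderiv I 𝒯 x) ∘L (normalSpace I f x).subtypeL ∘L
        normalPart I f x)

variable {C : Π x : M, normalSpace I f x →L[ℝ] normalSpace I f x}

theorem ambientEnd_mvfderiv (hf : IsIsometricImmersion I f) (x : M) (u : TangentSpace I x) :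
    ambientEnd f 𝒯 C x (mvfderiv I f x u) = mvfderiv I 𝒯 x u := by
  simp [ambientEnd, adjoint_mvfderiv_mvfderiv hf, normalPart_mvfderiv]

theorem ambientEnd_normal (x : M) (η : normalSpace I f x) :
    ambientEnd f 𝒯 C x η = mvfderiv I f x (bendingY f 𝒯 x η) + (C x η : F) := by
  simp [ambientEnd, adjoint_mvfderiv_normal, normalPart_normal, bendingY]
  abel

theorem contMDiff_ambientEnd (hf : IsIsometricImmersion I f)
    (h𝒯 : IsInfinitesimalBending I f 𝒯) (hC : IsSmoothNormalEnd I f C) :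
    ContMDiff I 𝓘(ℝ, F →L[ℝ] F) ∞ (ambientEnd f 𝒯 C) := by
  intro x
  refine ContMDiffAt.add ?_ ((hC x).sub ?_) <;> refine contMDiffAt_clm_of_apply fun w ↦ ?_
  · exact contMDiffAt_mvfderiv h𝒯.contMDiff
      (contMDiffAt_adjoint_mvfderiv hf hf.contMDiff contMDiffAt_const)
  · exact contMDiffAt_mvfderiv hf.contMDiff
      (contMDiffAt_adjoint_mvfderiv hf h𝒯.contMDiff (contMDiff_normalPart hf contMDiff_const x))

/-- Skewness is checked blockwise: the tangent block is the bending equation, the mixed blocks are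
the definition of 𝒴, and the normal block is the skewness of C. -/
theorem inner_ambientEnd (hf : IsIsometricImmersion I f) (h𝒯 : IsInfinitesimalBending I f 𝒯)
    (hC : ∀ (x : M) (η ξ : normalSpace I f x), ⟪C x η, ξ⟫_ℝ = -⟪η, C x ξ⟫_ℝ) (x : M) (a b : F) :
    ⟪ambientEnd f 𝒯 C x a, b⟫_ℝ = -⟪a, ambientEnd f 𝒯 C x b⟫_ℝ := by
  rw [← mvfderiv_adjoint_add_normalPart hf x a, ← mvfderiv_adjoint_add_normalPart hf x b]
  generalize adjoint (mvfderiv I f x) a = u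
  generalize adjoint (mvfderiv I f x) b = v
  generalize normalPart I f x a = η
  generalize normalPart I f x b = ξ
  simp only [map_add, ambientEnd_mvfderiv hf, ambientEnd_normal, inner_add_left, inner_add_right]
  have h1 := h𝒯.inner_add_inner x u v
  have h2 := hC x η ξ
  have h3 := inner_bendingY f 𝒯 x η v
  have h4 := inner_bendingY f 𝒯 x ξ u
  rw [Submodule.coe_inner, Submodule.coe_inner] at h2
  have h5 := inner_mvfderiv_normal x (bendingY f 𝒯 x η) ξ
  have h6 := inner_mvfderiv_normal x v (C x η)
  have h7 := inner_mvfderiv_normal x u (C x ξ)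
  have h8 := inner_mvfderiv_normal x (bendingY f 𝒯 x ξ) η
  rw [real_inner_comm] at h6 h8
  rw [← hf.inner_map] at h3 h4
  rw [real_inner_comm, real_inner_comm _ (ξ : F)] at h4
  linarith

/-- Skewness is a linear condition, so it passes to the derivative; A ↦ ⟨b, A a⟩ is the linear
functional to differentiate. -/
theorem inner_mvfderiv_ambientEnd (hf : IsIsometricImmersion I f)
    (h𝒯 : IsInfinitesimalBending I f 𝒯) (hCs : IsSmoothNormalEnd I f C)
    (hC : ∀ (x : M) (η ξ : normalSpace I f x), ⟪C x η, ξ⟫_ℝ = -⟪η, C x ξ⟫_ℝ) (x : M)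
    (X : TangentSpace I x) (a b : F) :
    ⟪mvfderiv I (ambientEnd f 𝒯 C) x X a, b⟫_ℝ =
      -⟪a, mvfderiv I (ambientEnd f 𝒯 C) x X b⟫_ℝ := by
  have hD : MDiffAt (ambientEnd f 𝒯 C) x :=
    (contMDiff_ambientEnd hf h𝒯 hCs).mdifferentiableAt (by simp)
  have key : ∀ a b : F, mvfderiv I (fun y ↦ ⟪b, ambientEnd f 𝒯 C y a⟫_ℝ) x X =
      ⟪b, mvfderiv I (ambientEnd f 𝒯 C) x X a⟫_ℝ := fun a b ↦
    mvfderiv_continuousLinearMap_comp ((innerSL ℝ b) ∘L ContinuousLinearMap.apply ℝ F a) hD X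
  have hneg : (fun y ↦ ⟪b, ambientEnd f 𝒯 C y a⟫_ℝ) =
      -(fun y ↦ ⟪a, ambientEnd f 𝒯 C y b⟫_ℝ) := by
    funext y
    rw [real_inner_comm, inner_ambientEnd hf h𝒯 hC, Pi.neg_apply]
  rw [real_inner_comm, ← key, ← key, hneg, mvfderiv_neg, neg_apply]

variable [I.Boundaryless]

/-- The product rule on 𝒟f_*Y = LY gives B(X,Y) - 𝒟α(X,Y), and both terms have tangential part 𝒴α
and normal part Cα. -/
theorem mvfderiv_ambientEnd_tangent (hf : IsIsometricImmersion I f)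
    (h𝒯 : IsInfinitesimalBending I f 𝒯) (hCs : IsSmoothNormalEnd I f C)
    (hβ : ∀ (x : M) (X Y : TangentSpace I x),
      bendingBeta hf h𝒯 x X Y = C x (secondFundamentalForm hf x X Y))
    (x : M) (X Y : TangentSpace I x) :
    mvfderiv I (ambientEnd f 𝒯 C) x X (mvfderiv I f x Y) = 0 := by
  have hD : MDiffAt (ambientEnd f 𝒯 C) x :=
    (contMDiff_ambientEnd hf h𝒯 hCs).mdifferentiableAt (by simp)
  have hY := mdiffAt_tangentExtension hf Y x
  have h1 := mvfderiv_clm_apply hD (mdiffAt_mvfderiv hf.contMDiff hY) X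
  have h2 := bendingB_apply hf h𝒯 X hY
  simp only [ambientEnd_mvfderiv hf] at h1
  rw [gauss_formula hf X hY, map_add, ambientEnd_mvfderiv hf, ambientEnd_normal] at h1
  have h3 := mvfderiv_adjoint_add_normalPart hf x (bendingB hf h𝒯 x X Y)
  rw [adjoint_bendingB hf h𝒯, show normalPart I f x (bendingB hf h𝒯 x X Y) = _ from hβ x X Y] at h3
  rw [tangentExtension_self hf] at h1 h2
  rw [h3, h2] at h1
  simpa using h1

theorem mvfderiv_ambientEnd_eq_zero (hf : IsIsometricImmersion I f)
    (h𝒯 : IsInfinitesimalBending I f 𝒯) (hCs : IsSmoothNormalEnd I f C)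
    (hC : ∀ (x : M) (η ξ : normalSpace I f x), ⟪C x η, ξ⟫_ℝ = -⟪η, C x ξ⟫_ℝ)
    (hβ : ∀ (x : M) (X Y : TangentSpace I x),
      bendingBeta hf h𝒯 x X Y = C x (secondFundamentalForm hf x X Y))
    (hE : ∀ (x : M) (X : TangentSpace I x) (η : Π x : M, normalSpace I f x),
      IsSmoothNormalSection I f η →
        bendingE hf 𝒯 x X (η x) = -normalConnectionEnd I f C x X η) (x : M) :
    mvfderiv I (ambientEnd f 𝒯 C) x = 0 := by
  ext1 X
  have htan := mvfderiv_ambientEnd_tangent hf h𝒯 hCs hβ x X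
  have hnor : ∀ ν : normalSpace I f x, mvfderiv I (ambientEnd f 𝒯 C) x X ν = 0 := by
    intro ν
    -- Skewness moves the derivative onto a tangent vector, where it is already zero.
    have hadj : adjoint (mvfderiv I f x) (mvfderiv I (ambientEnd f 𝒯 C) x X ν) = 0 := by
      refine ext_inner_right ℝ fun u ↦ ?_
      rw [adjoint_inner_left, inner_mvfderiv_ambientEnd hf h𝒯 hCs hC, htan, inner_zero_right,
        neg_zero, inner_zero_left]
    have hnp : normalPart I f x (mvfderiv I (ambientEnd f 𝒯 C) x X ν) = 0 := by
      let η (y : M) : normalSpace I f y := normalPart I f y (ν : F)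
      have hη : IsSmoothNormalSection I f η := contMDiff_normalPart hf contMDiff_const
      have hηx : η x = ν := normalPart_normal x ν
      have hηd : MDiffAt (fun y ↦ (η y : F)) x := hη.mdifferentiableAt (by simp)
      have hD : MDiffAt (ambientEnd f 𝒯 C) x :=
        (contMDiff_ambientEnd hf h𝒯 hCs).mdifferentiableAt (by simp)
      have hYd := (contMDiffAt_bendingY hf h𝒯 hη x).mdifferentiableAt (by simp)
      have hCη : MDiffAt (fun y ↦ (C y (η y) : F)) x := by
        -- Smoothness of C is stated for its extension by zero; on η the inner projection is the
        -- identity.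
        have h0 := (hCs.clm_apply hη).mdifferentiableAt (x := x) (by simp)
        simpa [normalPart_normal] using h0
      have h1 := mvfderiv_clm_apply hD hηd X
      simp only [ambientEnd_normal] at h1
      rw [mvfderiv_fun_add (mdiffAt_mvfderiv hf.contMDiff hYd) hCη, add_apply,
        weingarten_formula hf X hηd, map_add, map_neg, ambientEnd_mvfderiv hf,
        ambientEnd_normal] at h1
      have h2 := congrArg (normalPart I f x) h1
      simp only [map_add, map_neg, normalPart_mvfderiv, normalPart_normal] at h2
      -- The differentiated f_*𝒴η contributes α(X, 𝒴η), the first half of ℰ; the Weingarten term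
      -- -f_*A_η X, mapped by 𝒟, supplies the second.
      rw [← secondFundamentalForm_apply hf X hYd] at h2
      have h3 := hE x X η hη
      rw [bendingE, normalConnectionEnd, eq_neg_iff_add_eq_zero] at h3
      have h4 : normalPart I f x (mvfderiv I (fun y ↦ (C y (η y) : F)) x X) =
        normalConnection I f (fun y ↦ C y (η y)) x X := rfl
      rw [h4, hηx] at h2
      rw [hηx] at h3
      rw [← h3, eq_comm, ← sub_eq_zero]
      rw [← sub_eq_zero] at h2
      rw [← h2]
      abel
    rw [← mvfderiv_adjoint_add_normalPart hf x (mvfderiv I (ambientEnd f 𝒯 C) x X ν), hadj, hnp]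
    simp
  ext1 w
  rw [← mvfderiv_adjoint_add_normalPart hf x w, map_add, htan, hnor]
  simp

theorem isTrivialBending_of_normalEnd [ConnectedSpace M] (hf : IsIsometricImmersion I f)
    (h𝒯 : IsInfinitesimalBending I f 𝒯) (hCs : IsSmoothNormalEnd I f C)
    (hC : ∀ (x : M) (η ξ : normalSpace I f x), ⟪C x η, ξ⟫_ℝ = -⟪η, C x ξ⟫_ℝ)
    (hβ : ∀ (x : M) (X Y : TangentSpace I x),
      bendingBeta hf h𝒯 x X Y = C x (secondFundamentalForm hf x X Y))
    (hE : ∀ (x : M) (X : TangentSpace I x) (η : Π x : M, normalSpace I f x),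
      IsSmoothNormalSection I f η →
        bendingE hf 𝒯 x X (η x) = -normalConnectionEnd I f C x X η) :
    IsTrivialBending f 𝒯 := by
  obtain ⟨x₀⟩ : Nonempty M := inferInstance
  have : IsManifold I 1 M := .of_le (n := ∞) (by norm_cast)
  set D := ambientEnd f 𝒯 C
  -- Parallel means constant here, because M is connected.
  have hDx : ∀ x, D x = D x₀ := fun x ↦ eq_of_mvfderiv_eq_zero (I := I)
    ((contMDiff_ambientEnd hf h𝒯 hCs).mdifferentiable (by simp))
    (mvfderiv_ambientEnd_eq_zero hf h𝒯 hCs hC hβ hE) x x₀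
  have hfd : MDiff f := hf.contMDiff.mdifferentiable (by simp)
  have h𝒯d : MDiff 𝒯 := h𝒯.contMDiff.mdifferentiable (by simp)
  have hDf : MDiff (fun y ↦ D x₀ (f y)) :=
    (((D x₀).contMDiff (n := ∞)).comp hf.contMDiff).mdifferentiable (by simp)
  have hv : ∀ x, 𝒯 x - D x₀ (f x) = 𝒯 x₀ - D x₀ (f x₀) := by
    intro x
    refine eq_of_mvfderiv_eq_zero (I := I) (g := fun y ↦ 𝒯 y - D x₀ (f y))
      (fun y ↦ (h𝒯d y).sub (hDf y)) (fun y ↦ ?_) x x₀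
    ext1 u
    rw [mvfderiv_fun_sub (h𝒯d y) (hDf y), sub_apply,
      mvfderiv_continuousLinearMap_comp _ (hfd y), ← hDx y,
      ambientEnd_mvfderiv hf, sub_self, zero_apply]
  exact ⟨(D x₀).toLinearMap, 𝒯 x₀ - D x₀ (f x₀), inner_ambientEnd hf h𝒯 hC x₀,
    fun x ↦ (add_eq_of_eq_sub' (hv x).symm).symm⟩

end TrivialBending

end InfBending

end

theorem mainTheorem6 {n m : ℕ} {M : Type*} [TopologicalSpace M] [T2Space M]
    [SecondCountableTopology M] [ConnectedSpace M]
    [ChartedSpace (EuclideanSpace ℝ (Fin n)) M] [IsManifold (𝓡 n) ∞ M]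
    [RiemannianBundle (fun x : M ↦ TangentSpace (𝓡 n) x)]
    [IsContMDiffRiemannianBundle (𝓡 n) ∞ (EuclideanSpace ℝ (Fin n))
      (fun x : M ↦ TangentSpace (𝓡 n) x)]
    (f : M → EuclideanSpace ℝ (Fin m)) (hf : InfBending.IsIsometricImmersion (𝓡 n) f)
    (𝒯 : M → EuclideanSpace ℝ (Fin m)) (h𝒯 : InfBending.IsInfinitesimalBending (𝓡 n) f 𝒯) :
    InfBending.IsTrivialBending f 𝒯 ↔
      ∃ C : Π x : M,
          InfBending.normalSpace (𝓡 n) f x →L[ℝ] InfBending.normalSpace (𝓡 n) f x,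
        InfBending.IsSmoothNormalEnd (𝓡 n) f C ∧
        (∀ (x : M) (η ξ : InfBending.normalSpace (𝓡 n) f x), ⟪C x η, ξ⟫_ℝ = -⟪η, C x ξ⟫_ℝ) ∧
        (∀ (x : M) (X Y : TangentSpace (𝓡 n) x),
          InfBending.bendingBeta hf h𝒯 x X Y =
            C x (InfBending.secondFundamentalForm hf x X Y)) ∧
        (∀ (x : M) (X : TangentSpace (𝓡 n) x) (η : Π x : M, InfBending.normalSpace (𝓡 n) f x),
          InfBending.IsSmoothNormalSection (𝓡 n) f η →
            InfBending.bendingE hf 𝒯 x X (η x) =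
              -InfBending.normalConnectionEnd (𝓡 n) f C x X η) := by
  constructor
  · rintro ⟨D, v, hD, h⟩
    have hD' : ∀ a b, ⟪LinearMap.toContinuousLinearMap D a, b⟫_ℝ =
      -⟪a, LinearMap.toContinuousLinearMap D b⟫_ℝ := hD
    have h' : ∀ x, 𝒯 x = LinearMap.toContinuousLinearMap D (f x) + v := h
    exact ⟨InfBending.normalCompression (𝓡 n) f (LinearMap.toContinuousLinearMap D),
      InfBending.isSmoothNormalEnd_normalCompression hf _,
      InfBending.inner_normalCompression hD',
      InfBending.bendingBeta_of_eq_add_const hf h𝒯 h',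
      fun x X _ hη ↦ InfBending.bendingE_of_eq_add_const hf h𝒯 hD' h' x X hη⟩
  · rintro ⟨C, hCs, hC, hβ, hE⟩
    exact InfBending.isTrivialBending_of_normalEnd hf h𝒯 hCs hC hβ hE
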